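/- All tournaments are irreflexive, antisymmetric and complete binary relations; an edge $(x,y)$ is written $x\to y$. For a tournament $T$, the age $\mathcal A(T)$ is the set of isomorphism types of the subtournaments induced by $T$ on the finite subsets of its vertex set, and the profile $\varphi_T(n)$ is the number of isomorphism types of subtournaments induced by $T$ on the $n$-element subsets of its vertex set. For an acyclic tournament $C=(A,<)$ (with edges $x\to y$ for $x<y$) define six tournaments: - $C_{3[C]}$ is the lexicographical product of the $3$-cycle $C_3$ by $C$: its vertex set is $V(C_3)\times A$, and $(p,x)\to(q,y)$ iff either $x=y$ and $p\to q$ in $C_3$, or $x<y$. - $V_{[C]}$ has vertex set $(A\times\{0,1\})\cup\{a\}$ with $a\notin A\times\{0,1\}$; $(x,i)\to(x',i')$ iff $x<x'$, or $x=x'$ and $i<i'$; moreover $a\to(x,0)$ and $(x,1)\to a$ for every $x\in A$. - $T_{[C]},U_{[C]},H_{[C]},K_{[C]}$ all have vertex set $A\times\{0,1\}$, and in each of them $(x,0)\to(x,1)$ for all $x\in A$ and $(x,0)\to(y,0)$ for all $x<y$. The remaining edges are, for all $x<y$ in $A$: - in $T_{[C]}$: $(x,1)\to(y,1)$, $(y,1)\to(x,0)$,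 $(y,0)\to(x,1)$; - in $U_{[C]}$: $(y,1)\to(x,1)$, $(x,0)\to(y,1)$, $(x,1)\to(y,0)$; - in $H_{[C]}$: $(x,1)\to(y,1)$, $(y,1)\to(x,0)$, $(x,1)\to(y,0)$; - in $K_{[C]}$: $(y,1)\to(x,1)$, $(y,1)\to(x,0)$, $(x,1)\to(y,0)$. Let $\omega=(\mathbb N,<)$, let $\omega^*$ be its dual (all edges reversed), and let $\mathfrak B$ be the set of the twelve tournaments $C_{3[C]},V_{[C]},T_{[C]},U_{[C]},H_{[C]},K_{[C]}$ with $C\in\{\omega,\omega^*\}$. Then the ages $\mathcal A(T)$, $T\in\mathfrak B$, form exactly six distinct sets, and these six sets are pairwise incomparable with respect to inclusion. Moreover, for each $T\in\mathfrak B$ there are real numbers $a>0$ and $c>1$ such that $\varphi_T(n)\ge a\,c^n$ for every integer $n\ge 0$. -/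

import Mathlib

/-- A tournament: a set of vertices with an irreflexive, antisymmetric and complete binary
relation, whose pairs are the edges. -/
structure Tournament where
  /-- The vertices. -/
  V : Type
  /-- `E x y` says that `(x, y)` is an edge. -/
  E : V → V → Prop
  irrefl : ∀ x, ¬ E x x
  antisymm : ∀ x y, E x y → E y x → x = y
  complete : ∀ x y, x ≠ y → E x y ∨ E y x

namespace Tournament

/-- The dual tournament: all edges are reversed. -/
def dual (T : Tournament) : Tournament where
  V := T.V
  E x y := T.E y x
  irrefl := T.irrefl
  antisymm x y h h' := T.antisymm x y h' h
  complete x y h := (T.complete x y h).symm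

/-- The subtournament induced on a set of vertices. -/
def restrict (T : Tournament) (A : Set T.V) : Tournament where
  V := A
  E x y := T.E x y
  irrefl x := T.irrefl x
  antisymm x y h h' := Subtype.ext (T.antisymm x y h h')
  complete x y h := T.complete x y (fun e => h (Subtype.ext e))

/-- Isomorphism of tournaments. -/
def Isomorphic (T T' : Tournament) : Prop := Nonempty (T.E ≃r T'.E)

instance isoSetoid : Setoid Tournament where
  r := Isomorphic
  iseqv :=
    ⟨fun T => ⟨RelIso.refl T.E⟩, fun ⟨e⟩ => ⟨e.symm⟩, fun ⟨e⟩ ⟨f⟩ => ⟨e.trans f⟩⟩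

/-- Isomorphism types of tournaments. -/
def IsoType : Type 1 := Quotient isoSetoid

/-- The isomorphism type of a tournament. -/
def isoType (T : Tournament) : IsoType := Quotient.mk isoSetoid T

/-- The age of `T`: the set of isomorphism types of the subtournaments induced by `T` on the
finite sets of vertices. -/
def age (T : Tournament) : Set IsoType :=
  {t | ∃ A : Finset T.V, (T.restrict (A : Set T.V)).isoType = t}

/-- The profile of `T`: the number of subtournaments induced by `T` on the `n`-element sets of
vertices, isomorphic tournaments being identified. -/
noncomputable def profile (T : Tournament) (n : ℕ) : ℕ :=
  {t | ∃ A : Finset T.V, A.card = n ∧ (T.restrict (A : Set T.V)).isoType = t}.ncard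

/-- The tournament `ω`: the natural numbers with their strict order. -/
def omega : Tournament where
  V := ℕ
  E x y := x < y
  irrefl x := lt_irrefl x
  antisymm _ _ h h' := absurd h (lt_asymm h')
  complete _ _ h := lt_or_gt_of_ne h

/-- The 3-cycle `0 → 1 → 2 → 0`. -/
def C3 : Tournament where
  V := Fin 3
  E x y := y = x + 1
  irrefl := by decide
  antisymm := by decide
  complete := by decide

/-- The lexicographical product `T.D`: every vertex of `D` is replaced by a copy of `T`. -/
def lexProd (T D : Tournament) : Tournament where
  V := T.V × D.V
  E p q := (p.2 = q.2 ∧ T.E p.1 q.1) ∨ D.E p.2 q.2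
  irrefl p := by
    rintro (⟨-, h⟩ | h)
    · exact T.irrefl _ h
    · exact D.irrefl _ h
  antisymm p q := by
    rintro (⟨e, h⟩ | h) (⟨e', h'⟩ | h')
    · exact Prod.ext (T.antisymm _ _ h h') e
    · rw [e] at h'; exact absurd h' (D.irrefl _)
    · rw [e'] at h; exact absurd h (D.irrefl _)
    · have e := D.antisymm _ _ h h'
      rw [e] at h; exact absurd h (D.irrefl _)
  complete p q hpq := by
    by_cases e : p.2 = q.2
    · rcases T.complete p.1 q.1 (fun e' => hpq (Prod.ext e' e)) with h | h
      · exact Or.inl (Or.inl ⟨e, h⟩)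
      · exact Or.inr (Or.inl ⟨e.symm, h⟩)
    · rcases D.complete _ _ e with h | h
      · exact Or.inl (Or.inr h)
      · exact Or.inr (Or.inr h)

/-- The tournament `C_{3[C]} = C₃.C`. -/
def C3Of (C : Tournament) : Tournament := lexProd C3 C

/-- The edges of `V_{[C]}`; the additional vertex `a` is `none`. -/
def VRel (C : Tournament) : Option (C.V × Fin 2) → Option (C.V × Fin 2) → Prop
  | some (x, i), some (x', i') => C.E x x' ∨ (x = x' ∧ i < i')
  | none, some (_, i') => i' = 0
  | some (_, i), none => i = 1
  | none, none => False

/-- The tournament `V_{[C]}`. -/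
def VOf (C : Tournament) : Tournament where
  V := Option (C.V × Fin 2)
  E := VRel C
  irrefl := by
    rintro (_ | ⟨x, i⟩)
    · exact id
    · rintro (h | ⟨-, h⟩)
      · exact C.irrefl _ h
      · exact lt_irrefl _ h
  antisymm := by
    rintro (_ | ⟨x, i⟩) (_ | ⟨y, j⟩) h h'
    · rfl
    · simp only [VRel] at h h'; omega
    · simp only [VRel] at h h'; omega
    · rcases h with h | ⟨e, h⟩ <;> rcases h' with h' | ⟨e', h'⟩
      · have e := C.antisymm _ _ h h'
        subst e; exact absurd h (C.irrefl _)
      · subst e'; exact absurd h (C.irrefl _)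
      · subst e; exact absurd h' (C.irrefl _)
      · exact absurd h (lt_asymm h')
  complete := by
    rintro (_ | ⟨x, i⟩) (_ | ⟨y, j⟩) h
    · exact absurd rfl h
    · simp only [VRel]; omega
    · simp only [VRel]; omega
    · by_cases e : x = y
      · subst e
        have hij : i ≠ j := fun e => h (by rw [e])
        rcases lt_or_gt_of_ne hij with h | h
        · exact Or.inl (Or.inr ⟨rfl, h⟩)
        · exact Or.inr (Or.inr ⟨rfl, h⟩)
      · rcases C.complete _ _ e with h | h
        · exact Or.inl (Or.inl h)
        · exact Or.inr (Or.inl h)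

/-- Ordered pairs of elements of `{0,1} × {0,1}`. -/
abbrev Arc : Type := (Fin 2 × Fin 2) × (Fin 2 × Fin 2)

/-- `h_i = ((0,i),(1,i))`. -/
def hArc (i : Fin 2) : Arc := ((0, i), (1, i))

/-- `v_i = ((i,0),(i,1))`. -/
def vArc (i : Fin 2) : Arc := ((i, 0), (i, 1))

/-- `d_i = ((0,i),(1,i+1))`, with `i + 1` taken modulo 2. -/
def dArc (i : Fin 2) : Arc := ((0, i), (1, i + 1))

/-- The edges of the directed graph `Δ(C,X)` on `V(C) × {0,1}`. -/
def DeltaRel (C : Tournament) (X : Finset Arc) (e f : C.V × Fin 2) : Prop :=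
  (e.1 = f.1 ∧ ((0, e.2), (0, f.2)) ∈ X) ∨
  (C.E e.1 f.1 ∧ ((0, e.2), (1, f.2)) ∈ X) ∨
  (C.E f.1 e.1 ∧ ((1, e.2), (0, f.2)) ∈ X)

/-- The condition on `X` under which `Δ(C,X)` is a tournament for every tournament `C`. -/
def Good (X : Finset Arc) : Prop :=
  (∀ i j : Fin 2, ((0, i), (0, j)) ∈ X → ((0, j), (0, i)) ∉ X) ∧
  (∀ i j : Fin 2, i ≠ j → ((0, i), (0, j)) ∈ X ∨ ((0, j), (0, i)) ∈ X) ∧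
  (∀ i j : Fin 2, ((0, i), (1, j)) ∈ X → ((1, j), (0, i)) ∉ X) ∧
  (∀ i j : Fin 2, ((0, i), (1, j)) ∈ X ∨ ((1, j), (0, i)) ∈ X)

/-- `Δ(C,X)` as a tournament. -/
def Delta (C : Tournament) (X : Finset Arc) (hX : Good X) : Tournament where
  V := C.V × Fin 2
  E := DeltaRel C X
  irrefl := by
    rintro ⟨x, i⟩ (⟨-, h⟩ | ⟨h, -⟩ | ⟨h, -⟩)
    · exact hX.1 i i h h
    · exact C.irrefl _ h
    · exact C.irrefl _ h
  antisymm := by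
    have hC : ∀ x y, C.E x y → ¬ C.E y x := fun x y h h' => by
      have e := C.antisymm _ _ h h'
      subst e; exact C.irrefl _ h
    rintro ⟨x, i⟩ ⟨y, j⟩ h h'
    exfalso
    simp only [DeltaRel] at h h'
    by_cases e : x = y
    · subst e
      have h1 := hX.1 i j
      have h2 := C.irrefl x
      tauto
    · have h1 := hC x y
      have h2 := hX.2.2.1 i j
      have h3 := hX.2.2.1 j i
      have e' : y ≠ x := fun h => e h.symm
      tauto
  complete := by
    rintro ⟨x, i⟩ ⟨y, j⟩ h
    simp only [DeltaRel]
    by_cases e : x = y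
    · subst e
      have h1 := hX.2.1 i j (fun e => h (by rw [e]))
      tauto
    · have h1 := C.complete x y e
      have h2 := hX.2.2.2 i j
      have h3 := hX.2.2.2 j i
      tauto

/-- The tournament `T_{[C]}`. -/
def TOf (C : Tournament) : Tournament :=
  Delta C {(dArc 0).swap, (dArc 1).swap, hArc 1, hArc 0, vArc 0} (by refine ⟨?_, ?_, ?_, ?_⟩ <;> decide)

/-- The tournament `U_{[C]}`. -/
def UOf (C : Tournament) : Tournament :=
  Delta C {dArc 0, dArc 1, (hArc 1).swap, hArc 0, vArc 0} (by refine ⟨?_, ?_, ?_, ?_⟩ <;> decide)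

/-- The tournament `H_{[C]}`. -/
def HOf (C : Tournament) : Tournament :=
  Delta C {(dArc 0).swap, dArc 1, hArc 1, hArc 0, vArc 0} (by refine ⟨?_, ?_, ?_, ?_⟩ <;> decide)

/-- The tournament `K_{[C]}`. -/
def KOf (C : Tournament) : Tournament :=
  Delta C {(dArc 0).swap, dArc 1, (hArc 1).swap, hArc 0, vArc 0} (by refine ⟨?_, ?_, ?_, ?_⟩ <;> decide)

/-- The set `𝔅_C` of the six tournaments built from `C`. -/
def frakBOf (C : Tournament) : Set Tournament :=
  {C3Of C, VOf C, TOf C, UOf C, HOf C, KOf C}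

/-- The set `𝔅 = 𝔅_ω ∪ 𝔅_{ω*}`. -/
def frakB : Set Tournament := frakBOf omega ∪ frakBOf omega.dual

end Tournament

namespace Tournament

/-! Each construction uses its chain only through the order on finite subsets, and any finite set of
naturals can be order-reversed inside ℕ. So `ω` and `ω*` give the same age for each construction
(`age_dual_eq`), and only the six tournaments over `ω` need study; the profile is determined by the
age.

Incomparability is witnessed by explicit tournaments on four, five or six vertices: an inclusion of
ages carries every finite pattern along (`Realizes.of_age_subset`), and whether a pattern occurs is
a matter of linear arithmetic on the positions of its vertices in the chain.

For exponential growth, a set of m bits is coded by an n-vertex subtournament with m about n/4. For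
all but `C3Of`, a vertex `a` dominates one chain and is dominated by another; once `a` is fixed both
chains are rigid, and the edge between their i-th terms is the i-th bit (`two_pow_le_of_chains`). At
most n codes share an isomorphism type, one for each image of `a`. In `C3Of` the code places the
i-th 3-cycle before or after the i-th point of a chain; 3-cycles are recognisable, so the bits are
again determined (`two_pow_le_c3Of`). The loss of a factor n is absorbed by lowering the base of the
exponential. -/

/-! ### Embeddings, ages and profiles. -/

theorem not_edge_of_edge (T : Tournament) {x y : T.V} (h : T.E x y) : ¬ T.E y x := fun h' => by
  have e := T.antisymm x y h h'
  subst e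
  exact T.irrefl x h

theorem ne_of_edge (T : Tournament) {x y : T.V} (h : T.E x y) : x ≠ y := by
  rintro rfl
  exact T.irrefl x h

/-- The tournament induced on `W` by an injection into the vertices of `T`. -/
def pullback (T : Tournament) {W : Type} (φ : W ↪ T.V) : Tournament where
  V := W
  E u v := T.E (φ u) (φ v)
  irrefl _ := T.irrefl _
  antisymm _ _ h h' := φ.injective (T.antisymm _ _ h h')
  complete _ _ h := T.complete _ _ (fun e => h (φ.injective e))

theorem isoType_pullback (T : Tournament) {W : Type} [Fintype W] (φ : W ↪ T.V) :
    (T.restrict ((Finset.univ.map φ : Finset T.V) : Set T.V)).isoType =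
      (T.pullback φ).isoType := by
  refine (Quotient.sound ?_ : (T.pullback φ).isoType = _).symm
  refine ⟨⟨Equiv.ofBijective
    (fun u => ⟨φ u, Finset.mem_coe.2 (Finset.mem_map_of_mem φ (Finset.mem_univ (α := W) u))⟩)
    ⟨fun u v h => φ.injective (congrArg Subtype.val h), ?_⟩, Iff.rfl⟩⟩
  rintro ⟨y, hy⟩
  obtain ⟨u, -, rfl⟩ := Finset.mem_map.1 (Finset.mem_coe.1 hy)
  exact ⟨u, rfl⟩

/-- A map preserving edges reflects them, and its pullback is isomorphic to its source. -/
theorem isoType_eq_pullback {S T : Tournament} (φ : S.V ↪ T.V)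
    (h : ∀ x y, S.E x y → T.E (φ x) (φ y)) : S.isoType = (T.pullback φ).isoType := by
  refine Quotient.sound ⟨⟨Equiv.refl _, fun {a b} => ⟨fun hab => ?_, h a b⟩⟩⟩
  by_contra hn
  have hne : a ≠ b := by
    rintro rfl
    exact T.irrefl _ hab
  rcases S.complete a b hne with h1 | h1
  · exact hn h1
  · exact T.not_edge_of_edge hab (h _ _ h1)

/-- Every finite subtournament of `T` embeds in `T'`. -/
def LocallyEmbeds (T T' : Tournament) : Prop :=
  ∀ A : Finset T.V, ∃ f : T.V → T'.V, ∀ x ∈ A, ∀ y ∈ A, T.E x y → T'.E (f x) (f y)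

theorem LocallyEmbeds.age_subset {T T' : Tournament} (h : LocallyEmbeds T T') :
    T.age ⊆ T'.age := by
  rintro _ ⟨A, rfl⟩
  obtain ⟨f, hf⟩ := h A
  have hinj : Function.Injective (fun x : A => f x) := by
    rintro ⟨x, hx⟩ ⟨y, hy⟩ hxy
    by_contra hne
    have hne' : x ≠ y := fun e => hne (Subtype.ext e)
    have hxy' : f x = f y := hxy
    rcases T.complete x y hne' with h1 | h1
    · exact T'.ne_of_edge (hf _ hx _ hy h1) hxy'
    · exact T'.ne_of_edge (hf _ hy _ hx h1) hxy'.symm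
  refine ⟨Finset.univ.map ⟨_, hinj⟩, ?_⟩
  rw [isoType_pullback]
  exact (isoType_eq_pullback (S := T.restrict (A : Set T.V)) ⟨_, hinj⟩
    fun x y hxy => hf _ x.2 _ y.2 hxy).symm

/-- Isomorphic subtournaments have equally many vertices, so the age determines the types of each
size. -/
theorem profile_eq_of_age_eq {T T' : Tournament} (h : T.age = T'.age) (n : ℕ) :
    T.profile n = T'.profile n := by
  have key : ∀ {T T' : Tournament}, T.age ⊆ T'.age →
      {t | ∃ A : Finset T.V, A.card = n ∧ (T.restrict (A : Set T.V)).isoType = t} ⊆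
      {t | ∃ A : Finset T'.V, A.card = n ∧ (T'.restrict (A : Set T'.V)).isoType = t} := by
    rintro T T' h t ⟨A, hA, rfl⟩
    obtain ⟨B, hB⟩ := h ⟨A, rfl⟩
    refine ⟨B, ?_, hB⟩
    obtain ⟨e⟩ := Quotient.exact hB
    have := Nat.card_congr e.toEquiv
    rw [← hA]
    simpa [restrict] using this
  exact congrArg Set.ncard (Set.Subset.antisymm (key h.subset) (key h.symm.subset))

/-! ### Interchanging `ω` and its dual. -/

theorem exists_reversing_on_finset (A : Finset ℕ) :
    ∃ f : ℕ → ℕ, ∀ x ∈ A, ∀ y ∈ A, x < y → f y < f x :=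
  ⟨fun x => A.sup id - x, fun _ _ _ hy hxy =>
    Nat.sub_lt_sub_left (lt_of_lt_of_le hxy (Finset.le_sup (f := id) hy)) hxy⟩

theorem locallyEmbeds_omega_dual : LocallyEmbeds omega omega.dual :=
  exists_reversing_on_finset

theorem locallyEmbeds_dual_omega : LocallyEmbeds omega.dual omega := fun A => by
  obtain ⟨f, hf⟩ := exists_reversing_on_finset A
  exact ⟨f, fun x hx y hy hxy => hf y hy x hx hxy⟩

theorem LocallyEmbeds.lexProd (T : Tournament) {C C' : Tournament} (h : LocallyEmbeds C C') :
    LocallyEmbeds (lexProd T C) (lexProd T C') := fun A => by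
  classical
  obtain ⟨g, hg⟩ := h (A.image fun p : T.V × C.V => p.2)
  refine ⟨fun p : T.V × C.V => (p.1, g p.2), fun x hx y hy hxy => ?_⟩
  rcases hxy with ⟨e, hxy⟩ | hxy
  · exact Or.inl ⟨congrArg g e, hxy⟩
  · exact Or.inr (hg _ (Finset.mem_image_of_mem _ hx) _ (Finset.mem_image_of_mem _ hy) hxy)

theorem LocallyEmbeds.delta (X : Finset Arc) (hX : Good X) {C C' : Tournament}
    (h : LocallyEmbeds C C') : LocallyEmbeds (Delta C X hX) (Delta C' X hX) := fun A => by
  classical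
  obtain ⟨g, hg⟩ := h (A.image fun p : C.V × Fin 2 => p.1)
  refine ⟨fun p : C.V × Fin 2 => (g p.1, p.2), fun x hx y hy hxy => ?_⟩
  have hx' := Finset.mem_image_of_mem (fun p : C.V × Fin 2 => p.1) hx
  have hy' := Finset.mem_image_of_mem (fun p : C.V × Fin 2 => p.1) hy
  rcases hxy with ⟨e, hxy⟩ | ⟨e, hxy⟩ | ⟨e, hxy⟩
  · exact Or.inl ⟨congrArg g e, hxy⟩
  · exact Or.inr (Or.inl ⟨hg _ hx' _ hy' e, hxy⟩)
  · exact Or.inr (Or.inr ⟨hg _ hy' _ hx' e, hxy⟩)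

theorem LocallyEmbeds.vOf {C C' : Tournament} (h : LocallyEmbeds C C') :
    LocallyEmbeds (VOf C) (VOf C') := fun A => by
  classical
  obtain ⟨g, hg⟩ := h ((Finset.eraseNone A).image fun p : C.V × Fin 2 => p.1)
  refine ⟨fun p : Option (C.V × Fin 2) => p.map fun q => (g q.1, q.2), fun x hx y hy hxy => ?_⟩
  rcases x with _ | ⟨x, i⟩ <;> rcases y with _ | ⟨y, j⟩
  · exact hxy
  · exact hxy
  · exact hxy
  · have hx' := Finset.mem_image_of_mem (fun p : C.V × Fin 2 => p.1) (Finset.mem_eraseNone.2 hx)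
    have hy' := Finset.mem_image_of_mem (fun p : C.V × Fin 2 => p.1) (Finset.mem_eraseNone.2 hy)
    rcases hxy with hxy | ⟨e, hxy⟩
    · exact Or.inl (hg _ hx' _ hy' hxy)
    · exact Or.inr ⟨congrArg g e, hxy⟩

/-- A construction which depends on its chain only up to local embedding gives the same age on
`ω` and on its dual. -/
theorem age_dual_eq {F : Tournament → Tournament}
    (hF : ∀ {C C'}, LocallyEmbeds C C' → LocallyEmbeds (F C) (F C')) :
    (F omega.dual).age = (F omega).age :=
  Set.Subset.antisymm (hF locallyEmbeds_dual_omega).age_subset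
    (hF locallyEmbeds_omega_dual).age_subset

/-! ### Counting coded subtournaments up to isomorphism. -/

/-- A type of size n is determined by a relation on `Fin n`. Finiteness matters because `Set.ncard`
is 0 on infinite sets, so it is monotone only below a finite set. -/
theorem finite_isoTypes_card (T : Tournament) (n : ℕ) :
    {t | ∃ A : Finset T.V, A.card = n ∧ (T.restrict (A : Set T.V)).isoType = t}.Finite := by
  have key : ∀ t : {t | ∃ A : Finset T.V, A.card = n ∧ (T.restrict (A : Set T.V)).isoType = t},
      ∃ φ : Fin n ↪ T.V, (T.pullback φ).isoType = t := by
    rintro ⟨_, A, hA, rfl⟩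
    refine ⟨(A.equivFinOfCardEq hA).symm.toEmbedding.trans (Function.Embedding.subtype _), ?_⟩
    exact Quotient.sound ⟨⟨(A.equivFinOfCardEq hA).symm, Iff.rfl⟩⟩
  choose φ hφ using key
  refine Finite.of_injective
    (fun t => fun i j : Fin n => T.E (φ t i) (φ t j)) fun t t' h => ?_
  apply Subtype.ext
  rw [← hφ t, ← hφ t']
  refine Quotient.sound ⟨⟨Equiv.refl _, fun {i j} => ?_⟩⟩
  exact (congrFun (congrFun h i) j).symm.to_iff

/-- If the subtournaments of `T` indexed by `ι`, with one marked vertex, are pairwise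
non-isomorphic, then there are at least `card ι / n` isomorphism types among them. -/
theorem card_le_mul_profile (T : Tournament) {W ι : Type} [Fintype W] [Fintype ι]
    (φ : ι → W ↪ T.V) (a : W)
    (h : ∀ w w' (e : W ≃ W), (∀ u v, T.E (φ w u) (φ w v) ↔ T.E (φ w' (e u)) (φ w' (e v))) →
      e a = a → w = w') :
    Fintype.card ι ≤ Fintype.card W * T.profile (Fintype.card W) := by
  classical
  -- Each fibre of the type map has at most `card W` elements: fix one member `w₀`, choose
  -- isomorphisms onto it, and record where they send `a`. Two members with the same record are
  -- joined by an isomorphism fixing `a`, hence are equal.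
  have h1 := Finset.card_le_mul_card_image (s := (Finset.univ : Finset ι))
    (f := fun w => (T.pullback (φ w)).isoType) (Fintype.card W) (by
      intro t ht
      obtain ⟨w₀, -, rfl⟩ := Finset.mem_image.1 ht
      have iso : ∀ w : {w // (T.pullback (φ w)).isoType = (T.pullback (φ w₀)).isoType},
          ∃ e : W ≃ W, ∀ u v, T.E (φ w u) (φ w v) ↔ T.E (φ w₀ (e u)) (φ w₀ (e v)) := by
        rintro ⟨w, hw⟩
        obtain ⟨e⟩ := Quotient.exact hw
        exact ⟨e.toEquiv, fun u v => e.map_rel_iff.symm⟩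
      choose e he using iso
      rw [← Fintype.card_subtype]
      refine (Fintype.card_congr (Equiv.subtypeEquivRight fun x => by simp)).trans_le
        (Fintype.card_le_of_injective (fun w => e w a) fun w w' hww => Subtype.ext ?_)
      refine h _ _ ((e w).trans (e w').symm) (fun u v => ?_) ?_
      · rw [he w, he w']
        simp
      · simp only [Equiv.trans_apply]
        exact (Equiv.symm_apply_eq _).2 hww)
  refine h1.trans (Nat.mul_le_mul_left _ ?_)
  rw [← Set.ncard_coe_finset]
  refine Set.ncard_le_ncard ?_ (T.finite_isoTypes_card _)
  rintro t ht
  obtain ⟨w, -, rfl⟩ := Finset.mem_image.1 (Finset.mem_coe.1 ht)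
  exact ⟨Finset.univ.map (φ w), by simp, T.isoType_pullback (φ w)⟩

theorem eq_id_of_strictMono_fin {n : ℕ} {f : Fin n → Fin n} (hf : StrictMono f) (i : Fin n) :
    f i = i :=
  le_antisymm hf.apply_le hf.le_apply

/-- The set of naturals below `m` coded by a finite set. -/
def codeSet {m : ℕ} (s : Finset (Fin m)) : Set ℕ := {i | ∃ h : i < m, (⟨i, h⟩ : Fin m) ∈ s}

theorem mem_codeSet {m : ℕ} (s : Finset (Fin m)) (i : Fin m) : (i : ℕ) ∈ codeSet s ↔ i ∈ s :=
  ⟨fun ⟨_, h⟩ => h, fun h => ⟨i.2, h⟩⟩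

/-- For every `w : Set ℕ` there are sequences `z`, `o` and a vertex `a` with `z i → z j` iff
`i < j`, `o i → o j` iff `r i j`, `o j → a → z i`, and `z i → o i` iff `i ∈ w`. -/
def HasChains {α : Type} (E : α → α → Prop) (r : ℕ → ℕ → Prop) : Prop :=
  ∀ w : Set ℕ, ∃ (z o : ℕ → α) (a : α), (∀ i j, E (z i) (z j) ↔ i < j) ∧ (∀ i, E a (z i)) ∧
    (∀ i, E (o i) a) ∧ (∀ i j, E (o i) (o j) ↔ r i j) ∧ ∀ i, E (z i) (o i) ↔ i ∈ w

/-- An isomorphism fixing `a` preserves its out-neighbours, the `z i`, and its in-neighbours, the `o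
i`. Both are finite chains, so it is the identity on each and preserves the bits. The surplus `p -
m` of terms `z i` carries no information; it pads the subtournament to any prescribed size. -/
theorem two_pow_le_of_chains (T : Tournament) (r : ℕ → ℕ → Prop)
    (hr : r = (fun i j => i < j) ∨ r = (fun i j => j < i))
    (h : HasChains T.E r) (m p : ℕ) (hmp : m ≤ p) :
    2 ^ m ≤ (p + m + 1) * T.profile (p + m + 1) := by
  choose z o a hz haz hoa ho hzo using fun s : Finset (Fin m) => h (codeSet s)
  let φ : Finset (Fin m) → Option (Fin p ⊕ Fin m) → T.V := fun s u =>
    match u with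
    | none => a s
    | some (.inl i) => z s i
    | some (.inr i) => o s i
  have hφ : ∀ s, Function.Injective (φ s) := by
    have hrne : ∀ i j, i ≠ j → r i j ∨ r j i := by
      intro i j hij
      rcases hr with rfl | rfl <;> simp only <;> omega
    rintro s (_ | i | i) (_ | j | j) hij
    · rfl
    · exact absurd hij (T.ne_of_edge (haz s j))
    · exact absurd hij.symm (T.ne_of_edge (hoa s j))
    · exact absurd hij.symm (T.ne_of_edge (haz s i))
    · have hij' : z s i = z s j := hij
      by_contra hne
      have : (i : ℕ) ≠ j := fun e => hne (by rw [Fin.ext e])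
      rcases lt_or_gt_of_ne this with hl | hl
      · exact T.ne_of_edge ((hz s _ _).2 hl) hij'
      · exact T.ne_of_edge ((hz s _ _).2 hl) hij'.symm
    · have hij' : z s i = o s j := hij
      exact absurd (hij' ▸ haz s i) (T.not_edge_of_edge (hoa s j))
    · exact absurd hij (T.ne_of_edge (hoa s i))
    · have hij' : o s i = z s j := hij
      exact absurd (hij' ▸ hoa s i) (T.not_edge_of_edge (haz s j))
    · have hij' : o s i = o s j := hij
      by_contra hne
      have : (i : ℕ) ≠ j := fun e => hne (by rw [Fin.ext e])
      rcases hrne _ _ this with hl | hl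
      · exact T.ne_of_edge ((ho s _ _).2 hl) hij'
      · exact T.ne_of_edge ((ho s _ _).2 hl) hij'.symm
  have main := T.card_le_mul_profile (fun s => (⟨φ s, hφ s⟩ : _ ↪ T.V)) none ?_
  · simpa using main
  intro s s' e he hea
  simp only [Function.Embedding.coeFn_mk] at he
  have hl : ∀ i : Fin p, ∃ j : Fin p, e (some (.inl i)) = some (.inl j) := by
    intro i
    have h1 := (he none (some (.inl i))).1 (haz s i)
    rw [hea] at h1
    rcases h2 : e (some (.inl i)) with _ | j | j
    · rw [h2] at h1
      exact absurd h1 (T.irrefl _)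
    · exact ⟨j, rfl⟩
    · rw [h2] at h1
      exact absurd h1 (T.not_edge_of_edge (hoa s' j))
  have hr' : ∀ i : Fin m, ∃ j : Fin m, e (some (.inr i)) = some (.inr j) := by
    intro i
    have h1 := (he (some (.inr i)) none).1 (hoa s i)
    rw [hea] at h1
    rcases h2 : e (some (.inr i)) with _ | j | j
    · rw [h2] at h1
      exact absurd h1 (T.irrefl _)
    · rw [h2] at h1
      exact absurd h1 (T.not_edge_of_edge (haz s' j))
    · exact ⟨j, rfl⟩
  choose f hf using hl
  choose g hg using hr'
  have hfm : StrictMono f := by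
    intro i j hij
    have h1 := (he (some (.inl i)) (some (.inl j))).1 ((hz s _ _).2 hij)
    rw [hf, hf] at h1
    exact (hz s' _ _).1 h1
  have hgr : ∀ i j : Fin m, r i j → r (g i) (g j) := by
    intro i j hij
    have h1 := (he (some (.inr i)) (some (.inr j))).1 ((ho s _ _).2 hij)
    rw [hg, hg] at h1
    exact (ho s' _ _).1 h1
  have hgm : StrictMono g := by
    rcases hr with rfl | rfl
    · exact fun i j hij => hgr i j hij
    · exact fun i j hij => hgr j i hij
  ext i
  have h1 := he (some (.inl (Fin.castLE hmp i))) (some (.inr i))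
  rw [hf, hg, eq_id_of_strictMono_fin hfm, eq_id_of_strictMono_fin hgm] at h1
  have h2 := (hzo s i).symm.trans (h1.trans (hzo s' i))
  rwa [mem_codeSet, mem_codeSet] at h2

/-- Exponential growth up to a linear factor gives exponential growth. -/
theorem exists_exponential_lower_bound (f : ℕ → ℕ) (h0 : 1 ≤ f 0)
    (h : ∀ n, 1 ≤ n → 2 ^ ((n - 1) / 4) ≤ n * f n) :
    ∃ a c : ℝ, 0 < a ∧ 1 < c ∧ ∀ n : ℕ, a * c ^ n ≤ (f n : ℝ) := by
  -- With c = 21/20, c ^ 8 ≤ 2 gives c ^ (2n) ≤ 2 n f(n). Bernoulli's inequality gives n / 20 ≤ c ^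
  -- n, so one of the two factors c ^ n pays for n, leaving c ^ n / 40 ≤ f(n).
  refine ⟨1 / 40, 21 / 20, by norm_num, by norm_num, fun n => ?_⟩
  rcases Nat.eq_zero_or_pos n with rfl | hn
  · have : (1 : ℝ) ≤ f 0 := by exact_mod_cast h0
    norm_num
    linarith
  have hn' : (0 : ℝ) < n := by exact_mod_cast hn
  have h1 : (2 : ℝ) ^ ((n - 1) / 4) ≤ n * f n := by exact_mod_cast h n hn
  have h2 : (21 / 20 : ℝ) ^ (2 * n) ≤ 2 * 2 ^ ((n - 1) / 4) := by
    calc (21 / 20 : ℝ) ^ (2 * n) ≤ (21 / 20 : ℝ) ^ (8 * ((n - 1) / 4 + 1)) :=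
          pow_le_pow_right₀ (by norm_num) (by omega)
      _ = ((21 / 20 : ℝ) ^ 8) ^ ((n - 1) / 4 + 1) := pow_mul _ _ _
      _ ≤ 2 ^ ((n - 1) / 4 + 1) := pow_le_pow_left₀ (by positivity) (by norm_num) _
      _ = 2 * 2 ^ ((n - 1) / 4) := pow_succ' _ _
  have h3 : (n : ℝ) / 20 ≤ (21 / 20) ^ n := by
    have := one_add_mul_le_pow (a := (1 / 20 : ℝ)) (by norm_num) n
    norm_num at this
    linarith
  have hpos : (0 : ℝ) < (21 / 20) ^ n := by positivity
  rw [two_mul n, pow_add] at h2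
  have h4 : (n : ℝ) / 20 * (21 / 20) ^ n ≤ 2 * (n * f n) :=
    (mul_le_mul_of_nonneg_right h3 hpos.le).trans (by linarith)
  refine le_of_mul_le_mul_left ?_ hn'
  linarith

theorem one_le_profile_zero (T : Tournament) : 1 ≤ T.profile 0 := by
  refine (Set.ncard_pos (T.finite_isoTypes_card 0)).2 ⟨_, ∅, rfl, rfl⟩

/-! ### Edges over `ω` as comparisons of naturals. -/

/-- The edges of `C3Of omega`. -/
def c3Edge : Fin 3 × ℕ → Fin 3 × ℕ → Prop := (C3Of omega).E

/-- The edges of `VOf omega`. -/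
def vEdge : Option (ℕ × Fin 2) → Option (ℕ × Fin 2) → Prop := (VOf omega).E

/-- The edges of `TOf omega`. -/
def tEdge : ℕ × Fin 2 → ℕ × Fin 2 → Prop := (TOf omega).E

/-- The edges of `UOf omega`. -/
def uEdge : ℕ × Fin 2 → ℕ × Fin 2 → Prop := (UOf omega).E

/-- The edges of `HOf omega`. -/
def hEdge : ℕ × Fin 2 → ℕ × Fin 2 → Prop := (HOf omega).E

/-- The edges of `KOf omega`. -/
def kEdge : ℕ × Fin 2 → ℕ × Fin 2 → Prop := (KOf omega).E

theorem tEdge_zero_zero (x y : ℕ) : tEdge (x, 0) (y, 0) ↔ x < y := by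
  change DeltaRel omega _ _ _ ↔ _
  simp [DeltaRel, dArc, hArc, vArc, omega, Prod.swap]

theorem tEdge_zero_one (x y : ℕ) : tEdge (x, 0) (y, 1) ↔ y ≤ x := by
  change DeltaRel omega _ _ _ ↔ _
  simp [DeltaRel, dArc, hArc, vArc, omega, Prod.swap]
  omega

theorem tEdge_one_zero (x y : ℕ) : tEdge (x, 1) (y, 0) ↔ y < x := by
  change DeltaRel omega _ _ _ ↔ _
  simp [DeltaRel, dArc, hArc, vArc, omega, Prod.swap]

theorem tEdge_one_one (x y : ℕ) : tEdge (x, 1) (y, 1) ↔ x < y := by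
  change DeltaRel omega _ _ _ ↔ _
  simp [DeltaRel, dArc, hArc, vArc, omega, Prod.swap]

theorem uEdge_zero_zero (x y : ℕ) : uEdge (x, 0) (y, 0) ↔ x < y := by
  change DeltaRel omega _ _ _ ↔ _
  simp [DeltaRel, dArc, hArc, vArc, omega, Prod.swap]

theorem uEdge_zero_one (x y : ℕ) : uEdge (x, 0) (y, 1) ↔ x ≤ y := by
  change DeltaRel omega _ _ _ ↔ _
  simp [DeltaRel, dArc, hArc, vArc, omega, Prod.swap]
  omega

theorem uEdge_one_zero (x y : ℕ) : uEdge (x, 1) (y, 0) ↔ x < y := by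
  change DeltaRel omega _ _ _ ↔ _
  simp [DeltaRel, dArc, hArc, vArc, omega, Prod.swap]

theorem uEdge_one_one (x y : ℕ) : uEdge (x, 1) (y, 1) ↔ y < x := by
  change DeltaRel omega _ _ _ ↔ _
  simp [DeltaRel, dArc, hArc, vArc, omega, Prod.swap]

theorem hEdge_zero_zero (x y : ℕ) : hEdge (x, 0) (y, 0) ↔ x < y := by
  change DeltaRel omega _ _ _ ↔ _
  simp [DeltaRel, dArc, hArc, vArc, omega, Prod.swap]

theorem hEdge_zero_one (x y : ℕ) : hEdge (x, 0) (y, 1) ↔ x = y := by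
  change DeltaRel omega _ _ _ ↔ _
  simp [DeltaRel, dArc, hArc, vArc, omega, Prod.swap]

theorem hEdge_one_zero (x y : ℕ) : hEdge (x, 1) (y, 0) ↔ x ≠ y := by
  change DeltaRel omega _ _ _ ↔ _
  simp [DeltaRel, dArc, hArc, vArc, omega, Prod.swap]

theorem hEdge_one_one (x y : ℕ) : hEdge (x, 1) (y, 1) ↔ x < y := by
  change DeltaRel omega _ _ _ ↔ _
  simp [DeltaRel, dArc, hArc, vArc, omega, Prod.swap]

theorem kEdge_zero_zero (x y : ℕ) : kEdge (x, 0) (y, 0) ↔ x < y := by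
  change DeltaRel omega _ _ _ ↔ _
  simp [DeltaRel, dArc, hArc, vArc, omega, Prod.swap]

theorem kEdge_zero_one (x y : ℕ) : kEdge (x, 0) (y, 1) ↔ x = y := by
  change DeltaRel omega _ _ _ ↔ _
  simp [DeltaRel, dArc, hArc, vArc, omega, Prod.swap]

theorem kEdge_one_zero (x y : ℕ) : kEdge (x, 1) (y, 0) ↔ x ≠ y := by
  change DeltaRel omega _ _ _ ↔ _
  simp [DeltaRel, dArc, hArc, vArc, omega, Prod.swap]

theorem kEdge_one_one (x y : ℕ) : kEdge (x, 1) (y, 1) ↔ y < x := by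
  change DeltaRel omega _ _ _ ↔ _
  simp [DeltaRel, dArc, hArc, vArc, omega, Prod.swap]

theorem c3Edge_iff (i j : Fin 3) (x y : ℕ) :
    c3Edge (i, x) (j, y) ↔ x = y ∧ j = i + 1 ∨ x < y := Iff.rfl

theorem vEdge_some_some (i j : Fin 2) (x y : ℕ) :
    vEdge (some (x, i)) (some (y, j)) ↔ x < y ∨ x = y ∧ i < j := Iff.rfl

theorem vEdge_none_left (j : Fin 2) (y : ℕ) :
    vEdge none (some (y, j)) ↔ j = 0 := Iff.rfl

theorem vEdge_none_right (i : Fin 2) (x : ℕ) :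
    vEdge (some (x, i)) none ↔ i = 1 := Iff.rfl

/-! ### Chains coding an arbitrary set of bits. -/

theorem exists_nat_indicator (w : Set ℕ) : ∃ c : ℕ → ℕ, ∀ i, c i ≤ 1 ∧ (i ∈ w ↔ c i = 1) := by
  classical
  refine ⟨fun i => if i ∈ w then 1 else 0, fun i => ?_⟩
  by_cases h : i ∈ w <;> simp [h]

theorem hasChains_tEdge : HasChains tEdge (fun i j => i < j) := fun w => by
  obtain ⟨c, hc⟩ := exists_nat_indicator w
  -- The bit puts `o i` at 3i + 1 or 3i + 3, on one side or the other of `z i` at 3i + 2; spacing 3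
  -- keeps the order of the `o i` independent of the bits.
  refine ⟨fun i => (3 * i + 2, 0), fun i => (3 * i + 3 - 2 * c i, 1), (0, 0), fun i j => ?_,
    fun i => ?_, fun i => ?_, fun i j => ?_, fun i => ?_⟩
  · simp only [tEdge_zero_zero]
    omega
  · simp only [tEdge_zero_zero]
    omega
  · have := hc i
    simp only [tEdge_one_zero]
    omega
  · have := hc i
    have := hc j
    simp only [tEdge_one_one]
    rcases eq_or_ne i j with rfl | h <;> omega
  · rw [(hc i).2]
    have := hc i
    simp only [tEdge_zero_one]
    omega

theorem hasChains_uEdge : HasChains uEdge (fun i j => j < i) := fun w => by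
  obtain ⟨c, hc⟩ := exists_nat_indicator w
  refine ⟨fun i => (3 * i + 2, 0), fun i => (3 * i + 1 + 2 * c i, 1), (0, 1), fun i j => ?_,
    fun i => ?_, fun i => ?_, fun i j => ?_, fun i => ?_⟩
  · simp only [uEdge_zero_zero]
    omega
  · simp only [uEdge_one_zero]
    omega
  · have := hc i
    simp only [uEdge_one_one]
    omega
  · have := hc i
    have := hc j
    simp only [uEdge_one_one]
    rcases eq_or_ne i j with rfl | h <;> omega
  · rw [(hc i).2]
    have := hc i
    simp only [uEdge_zero_one]
    omega

theorem hasChains_hEdge : HasChains hEdge (fun i j => i < j) := fun w => by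
  obtain ⟨c, hc⟩ := exists_nat_indicator w
  -- Here an edge from level 0 to level 1 requires equal positions, so the bit decides whether `o i`
  -- shares the position 2i + 1 of `z i` or sits one further.
  refine ⟨fun i => (2 * i + 1, 0), fun i => (2 * i + 2 - c i, 1), (0, 0), fun i j => ?_,
    fun i => ?_, fun i => ?_, fun i j => ?_, fun i => ?_⟩
  · simp only [hEdge_zero_zero]
    omega
  · simp only [hEdge_zero_zero]
    omega
  · have := hc i
    simp only [hEdge_one_zero]
    omega
  · have := hc i
    have := hc j
    simp only [hEdge_one_one]
    rcases eq_or_ne i j with rfl | h <;> omega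
  · rw [(hc i).2]
    have := hc i
    simp only [hEdge_zero_one]
    omega

theorem hasChains_kEdge : HasChains kEdge (fun i j => j < i) := fun w => by
  obtain ⟨c, hc⟩ := exists_nat_indicator w
  refine ⟨fun i => (2 * i + 1, 0), fun i => (2 * i + 2 - c i, 1), (0, 0), fun i j => ?_,
    fun i => ?_, fun i => ?_, fun i j => ?_, fun i => ?_⟩
  · simp only [kEdge_zero_zero]
    omega
  · simp only [kEdge_zero_zero]
    omega
  · have := hc i
    simp only [kEdge_one_zero]
    omega
  · have := hc i
    have := hc j
    simp only [kEdge_one_one]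
    rcases eq_or_ne i j with rfl | h <;> omega
  · rw [(hc i).2]
    have := hc i
    simp only [kEdge_zero_one]
    omega

theorem hasChains_vEdge : HasChains vEdge (fun i j => i < j) := fun w => by
  obtain ⟨c, hc⟩ := exists_nat_indicator w
  refine ⟨fun i => some (3 * i + 1, 0), fun i => some (3 * i + 2 * c i, 1), none, fun i j => ?_,
    fun i => ?_, fun i => ?_, fun i j => ?_, fun i => ?_⟩
  · simp only [vEdge_some_some]
    omega
  · simp only [vEdge_none_left]
  · have := hc i
    simp only [vEdge_none_right]
  · have := hc i
    have := hc j
    simp only [vEdge_some_some]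
    rcases eq_or_ne i j with rfl | h <;> omega
  · rw [(hc i).2]
    have := hc i
    simp only [vEdge_some_some]
    omega

/-! ### Small tournaments separating the ages. -/

/-- The directed graph on `Fin k` with the listed edges maps into the relation `E`. -/
def Realizes {α : Type} (E : α → α → Prop) {k : ℕ} (L : List (Fin k × Fin k)) : Prop :=
  ∃ f : Fin k → α, ∀ e ∈ L, E (f e.1) (f e.2)

/-- The image of a realization is a finite subtournament, so it has an isomorphic copy in `T'`. -/
theorem Realizes.of_age_subset {T T' : Tournament} (h : T.age ⊆ T'.age) {k : ℕ}
    {L : List (Fin k × Fin k)} (hL : Realizes T.E L) : Realizes T'.E L := by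
  classical
  obtain ⟨f, hf⟩ := hL
  obtain ⟨B, hB⟩ := h ⟨Finset.univ.image f, rfl⟩
  obtain ⟨e⟩ := Quotient.exact hB.symm
  have hmem : ∀ i, f i ∈ ((Finset.univ.image f : Finset T.V) : Set T.V) := fun i =>
    Finset.mem_coe.2 (Finset.mem_image_of_mem f (Finset.mem_univ i))
  exact ⟨fun i => (e ⟨f i, hmem i⟩).1, fun d hd => (e.map_rel_iff
    (a := ⟨f d.1, hmem d.1⟩) (b := ⟨f d.2, hmem d.2⟩)).2 (hf d hd)⟩

theorem not_age_subset {T T' : Tournament} {k : ℕ} {L : List (Fin k × Fin k)}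
    (h : Realizes T.E L) (h' : ¬ Realizes T'.E L) : ¬ T.age ⊆ T'.age := fun hs =>
  h' (h.of_age_subset hs)

/-- A tournament on five vertices in the ages of `V_{[C]}` and `H_{[C]}` only. -/
def fiveVH : List (Fin 5 × Fin 5) :=
  [(0, 4), (1, 0), (2, 0), (2, 1), (2, 4), (3, 0), (3, 1), (3, 2), (4, 1), (4, 3)]

/-- A tournament on five vertices in the ages of `U_{[C]}` and `H_{[C]}` only. -/
def fiveUH : List (Fin 5 × Fin 5) :=
  [(0, 4), (1, 0), (1, 3), (2, 0), (2, 1), (3, 0), (3, 2), (3, 4), (4, 1), (4, 2)]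

/-- A tournament on five vertices in the age of `V_{[C]}` and `U_{[C]}` but not of `H_{[C]}`. -/
def fiveVU : List (Fin 5 × Fin 5) :=
  [(0, 4), (1, 0), (1, 4), (2, 0), (2, 1), (3, 0), (3, 1), (3, 2), (4, 2), (4, 3)]

/-- The regular tournament on five vertices. -/
def regularFive : List (Fin 5 × Fin 5) :=
  [(0, 3), (0, 4), (1, 0), (1, 4), (2, 0), (2, 1), (3, 1), (3, 2), (4, 2), (4, 3)]

/-- A tournament on five vertices in the age of `K_{[C]}` only. -/
def fiveK : List (Fin 5 × Fin 5) :=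
  [(0, 4), (1, 0), (1, 3), (2, 0), (2, 1), (3, 0), (3, 2), (4, 1), (4, 2), (4, 3)]

/-- The strongly connected tournament on four vertices. -/
def strongFour : List (Fin 4 × Fin 4) :=
  [(0, 3), (1, 0), (2, 0), (2, 1), (3, 1), (3, 2)]

/-- Two disjoint 3-cycles, the first of which dominates the second. -/
def doubleCycle : List (Fin 6 × Fin 6) :=
  [(0, 1), (0, 3), (0, 4), (0, 5), (1, 2), (1, 3), (1, 4), (1, 5), (2, 0), (2, 3), (2, 4),
    (2, 5), (3, 4), (4, 5), (5, 3)]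

theorem fin_two_eq_zero_or_one (c : Fin 2) : c = 0 ∨ c = 1 := by omega

/-- Once the level of every vertex is fixed, each edge is a comparison of two naturals, so finitely
many linear problems remain, one per assignment of levels. -/
theorem not_realizes_of_coordinates {E : ℕ × Fin 2 → ℕ × Fin 2 → Prop} {k : ℕ}
    {L : List (Fin k × Fin k)}
    (h : ∀ (x : Fin k → ℕ) (c : Fin k → Fin 2), ¬ ∀ e ∈ L, E (x e.1, c e.1) (x e.2, c e.2)) :
    ¬ Realizes E L := fun ⟨f, hf⟩ =>
  h (fun i => (f i).1) (fun i => (f i).2) hf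

/-- Without the additional vertex, `VOf omega` is a lexicographic product of chains, hence
transitive; so every 3-cycle passes through `none`. -/
theorem vEdge_exists_eq_none_of_cycle {p q s : Option (ℕ × Fin 2)} (h1 : vEdge p q)
    (h2 : vEdge q s) (h3 : vEdge s p) : p = none ∨ q = none ∨ s = none := by
  rcases p with _ | ⟨x, i⟩
  · exact Or.inl rfl
  rcases q with _ | ⟨y, j⟩
  · exact Or.inr (Or.inl rfl)
  rcases s with _ | ⟨z, k⟩
  · exact Or.inr (Or.inr rfl)
  simp only [vEdge_some_some] at h1 h2 h3
  omega

theorem realizes_c3Edge_doubleCycle : Realizes c3Edge doubleCycle := by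
  refine ⟨![(0, 0), (1, 0), (2, 0), (0, 1), (1, 1), (2, 1)], ?_⟩
  simp [doubleCycle, c3Edge_iff]

theorem realizes_hEdge_strongFour : Realizes hEdge strongFour := by
  refine ⟨![(0, 0), (2, 1), (1, 1), (0, 1)], ?_⟩
  simp [strongFour, hEdge_zero_one, hEdge_one_zero, hEdge_one_one]

theorem realizes_hEdge_fiveUH : Realizes hEdge fiveUH := by
  refine ⟨![(1, 0), (0, 0), (2, 1), (0, 1), (1, 1)], ?_⟩
  simp [fiveUH, hEdge_zero_zero, hEdge_zero_one, hEdge_one_zero, hEdge_one_one]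

theorem realizes_hEdge_fiveVH : Realizes hEdge fiveVH := by
  refine ⟨![(2, 0), (1, 0), (0, 1), (0, 0), (2, 1)], ?_⟩
  simp [fiveVH, hEdge_zero_zero, hEdge_zero_one, hEdge_one_zero, hEdge_one_one]

theorem realizes_kEdge_fiveK : Realizes kEdge fiveK := by
  refine ⟨![(2, 0), (0, 0), (1, 1), (1, 0), (2, 1)], ?_⟩
  simp [fiveK, kEdge_zero_zero, kEdge_zero_one, kEdge_one_zero, kEdge_one_one]

theorem realizes_kEdge_strongFour : Realizes kEdge strongFour := by
  refine ⟨![(1, 0), (0, 1), (0, 0), (1, 1)], ?_⟩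
  simp [strongFour, kEdge_zero_zero, kEdge_zero_one, kEdge_one_zero, kEdge_one_one]

theorem realizes_tEdge_regularFive : Realizes tEdge regularFive := by
  refine ⟨![(0, 0), (2, 1), (1, 1), (2, 0), (1, 0)], ?_⟩
  simp [regularFive, tEdge_zero_zero, tEdge_zero_one, tEdge_one_zero, tEdge_one_one]

theorem realizes_tEdge_strongFour : Realizes tEdge strongFour := by
  refine ⟨![(0, 0), (2, 1), (1, 1), (2, 0)], ?_⟩
  simp [strongFour, tEdge_zero_zero, tEdge_zero_one, tEdge_one_zero, tEdge_one_one]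

theorem realizes_uEdge_strongFour : Realizes uEdge strongFour := by
  refine ⟨![(2, 0), (0, 1), (1, 1), (2, 1)], ?_⟩
  simp [strongFour, uEdge_zero_one, uEdge_one_zero, uEdge_one_one]

theorem realizes_uEdge_fiveUH : Realizes uEdge fiveUH := by
  refine ⟨![(2, 0), (0, 1), (1, 1), (1, 0), (2, 1)], ?_⟩
  simp [fiveUH, uEdge_zero_zero, uEdge_zero_one, uEdge_one_zero, uEdge_one_one]

theorem realizes_uEdge_fiveVU : Realizes uEdge fiveVU := by
  refine ⟨![(3, 0), (2, 0), (0, 1), (1, 1), (3, 1)], ?_⟩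
  simp [fiveVU, uEdge_zero_zero, uEdge_zero_one, uEdge_one_zero, uEdge_one_one]

theorem realizes_vEdge_strongFour : Realizes vEdge strongFour := by
  refine ⟨![some (1, 1), some (1, 0), some (0, 0), none], ?_⟩
  simp [strongFour, vEdge_some_some, vEdge_none_left, vEdge_none_right]

theorem realizes_vEdge_fiveVH : Realizes vEdge fiveVH := by
  refine ⟨![some (1, 1), some (1, 0), some (0, 1), some (0, 0), none], ?_⟩
  simp [fiveVH, vEdge_some_some, vEdge_none_left, vEdge_none_right]

theorem realizes_vEdge_fiveVU : Realizes vEdge fiveVU := by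
  refine ⟨![some (2, 1), some (1, 1), some (1, 0), some (0, 0), none], ?_⟩
  simp [fiveVU, vEdge_some_some, vEdge_none_left, vEdge_none_right]

/-- A strongly connected subtournament of `C3Of omega` lies in a single copy of the 3-cycle, which
has only three vertices. -/
theorem not_realizes_c3Edge_strongFour : ¬ Realizes c3Edge strongFour := by
  rintro ⟨f, hf⟩
  simp only [strongFour, List.forall_mem_cons, List.not_mem_nil, false_implies, implies_true,
    and_true] at hf
  generalize f 0 = p0 at hf
  obtain ⟨c0, x0⟩ := p0
  generalize f 1 = p1 at hf
  obtain ⟨c1, x1⟩ := p1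
  generalize f 2 = p2 at hf
  obtain ⟨c2, x2⟩ := p2
  generalize f 3 = p3 at hf
  obtain ⟨c3, x3⟩ := p3
  simp only [c3Edge_iff] at hf
  omega

theorem not_realizes_hEdge_doubleCycle : ¬ Realizes hEdge doubleCycle := by
  refine not_realizes_of_coordinates fun x c hf => ?_
  simp only [doubleCycle, List.forall_mem_cons, List.not_mem_nil, false_implies, implies_true,
    and_true] at hf
  rcases fin_two_eq_zero_or_one (c 0) with h0 | h0 <;>
  rcases fin_two_eq_zero_or_one (c 1) with h1 | h1 <;>
  rcases fin_two_eq_zero_or_one (c 2) with h2 | h2 <;>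
  rcases fin_two_eq_zero_or_one (c 3) with h3 | h3 <;>
  rcases fin_two_eq_zero_or_one (c 4) with h4 | h4 <;>
  rcases fin_two_eq_zero_or_one (c 5) with h5 | h5 <;>
  simp only [h0, h1, h2, h3, h4, h5, hEdge_zero_zero, hEdge_zero_one, hEdge_one_zero, hEdge_one_one] at hf <;>
  omega

theorem not_realizes_hEdge_fiveK : ¬ Realizes hEdge fiveK := by
  refine not_realizes_of_coordinates fun x c hf => ?_
  simp only [fiveK, List.forall_mem_cons, List.not_mem_nil, false_implies, implies_true,
    and_true] at hf
  rcases fin_two_eq_zero_or_one (c 0) with h0 | h0 <;>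
  rcases fin_two_eq_zero_or_one (c 1) with h1 | h1 <;>
  rcases fin_two_eq_zero_or_one (c 2) with h2 | h2 <;>
  rcases fin_two_eq_zero_or_one (c 3) with h3 | h3 <;>
  rcases fin_two_eq_zero_or_one (c 4) with h4 | h4 <;>
  simp only [h0, h1, h2, h3, h4, hEdge_zero_zero, hEdge_zero_one, hEdge_one_zero, hEdge_one_one] at hf <;>
  omega

theorem not_realizes_hEdge_regularFive : ¬ Realizes hEdge regularFive := by
  refine not_realizes_of_coordinates fun x c hf => ?_
  simp only [regularFive, List.forall_mem_cons, List.not_mem_nil, false_implies, implies_true,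
    and_true] at hf
  rcases fin_two_eq_zero_or_one (c 0) with h0 | h0 <;>
  rcases fin_two_eq_zero_or_one (c 1) with h1 | h1 <;>
  rcases fin_two_eq_zero_or_one (c 2) with h2 | h2 <;>
  rcases fin_two_eq_zero_or_one (c 3) with h3 | h3 <;>
  rcases fin_two_eq_zero_or_one (c 4) with h4 | h4 <;>
  simp only [h0, h1, h2, h3, h4, hEdge_zero_zero, hEdge_zero_one, hEdge_one_zero, hEdge_one_one] at hf <;>
  omega

theorem not_realizes_hEdge_fiveVU : ¬ Realizes hEdge fiveVU := by
  refine not_realizes_of_coordinates fun x c hf => ?_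
  simp only [fiveVU, List.forall_mem_cons, List.not_mem_nil, false_implies, implies_true,
    and_true] at hf
  rcases fin_two_eq_zero_or_one (c 0) with h0 | h0 <;>
  rcases fin_two_eq_zero_or_one (c 1) with h1 | h1 <;>
  rcases fin_two_eq_zero_or_one (c 2) with h2 | h2 <;>
  rcases fin_two_eq_zero_or_one (c 3) with h3 | h3 <;>
  rcases fin_two_eq_zero_or_one (c 4) with h4 | h4 <;>
  simp only [h0, h1, h2, h3, h4, hEdge_zero_zero, hEdge_zero_one, hEdge_one_zero, hEdge_one_one] at hf <;>
  omega

theorem not_realizes_kEdge_doubleCycle : ¬ Realizes kEdge doubleCycle := by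
  refine not_realizes_of_coordinates fun x c hf => ?_
  simp only [doubleCycle, List.forall_mem_cons, List.not_mem_nil, false_implies, implies_true,
    and_true] at hf
  rcases fin_two_eq_zero_or_one (c 0) with h0 | h0 <;>
  rcases fin_two_eq_zero_or_one (c 1) with h1 | h1 <;>
  rcases fin_two_eq_zero_or_one (c 2) with h2 | h2 <;>
  rcases fin_two_eq_zero_or_one (c 3) with h3 | h3 <;>
  rcases fin_two_eq_zero_or_one (c 4) with h4 | h4 <;>
  rcases fin_two_eq_zero_or_one (c 5) with h5 | h5 <;>
  simp only [h0, h1, h2, h3, h4, h5, kEdge_zero_zero, kEdge_zero_one, kEdge_one_zero, kEdge_one_one] at hf <;>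
  omega

theorem not_realizes_kEdge_regularFive : ¬ Realizes kEdge regularFive := by
  refine not_realizes_of_coordinates fun x c hf => ?_
  simp only [regularFive, List.forall_mem_cons, List.not_mem_nil, false_implies, implies_true,
    and_true] at hf
  rcases fin_two_eq_zero_or_one (c 0) with h0 | h0 <;>
  rcases fin_two_eq_zero_or_one (c 1) with h1 | h1 <;>
  rcases fin_two_eq_zero_or_one (c 2) with h2 | h2 <;>
  rcases fin_two_eq_zero_or_one (c 3) with h3 | h3 <;>
  rcases fin_two_eq_zero_or_one (c 4) with h4 | h4 <;>
  simp only [h0, h1, h2, h3, h4, kEdge_zero_zero, kEdge_zero_one, kEdge_one_zero, kEdge_one_one] at hf <;>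
  omega

theorem not_realizes_kEdge_fiveUH : ¬ Realizes kEdge fiveUH := by
  refine not_realizes_of_coordinates fun x c hf => ?_
  simp only [fiveUH, List.forall_mem_cons, List.not_mem_nil, false_implies, implies_true,
    and_true] at hf
  rcases fin_two_eq_zero_or_one (c 0) with h0 | h0 <;>
  rcases fin_two_eq_zero_or_one (c 1) with h1 | h1 <;>
  rcases fin_two_eq_zero_or_one (c 2) with h2 | h2 <;>
  rcases fin_two_eq_zero_or_one (c 3) with h3 | h3 <;>
  rcases fin_two_eq_zero_or_one (c 4) with h4 | h4 <;>
  simp only [h0, h1, h2, h3, h4, kEdge_zero_zero, kEdge_zero_one, kEdge_one_zero, kEdge_one_one] at hf <;>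
  omega

theorem not_realizes_kEdge_fiveVH : ¬ Realizes kEdge fiveVH := by
  refine not_realizes_of_coordinates fun x c hf => ?_
  simp only [fiveVH, List.forall_mem_cons, List.not_mem_nil, false_implies, implies_true,
    and_true] at hf
  rcases fin_two_eq_zero_or_one (c 0) with h0 | h0 <;>
  rcases fin_two_eq_zero_or_one (c 1) with h1 | h1 <;>
  rcases fin_two_eq_zero_or_one (c 2) with h2 | h2 <;>
  rcases fin_two_eq_zero_or_one (c 3) with h3 | h3 <;>
  rcases fin_two_eq_zero_or_one (c 4) with h4 | h4 <;>
  simp only [h0, h1, h2, h3, h4, kEdge_zero_zero, kEdge_zero_one, kEdge_one_zero, kEdge_one_one] at hf <;>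
  omega

theorem not_realizes_tEdge_doubleCycle : ¬ Realizes tEdge doubleCycle := by
  refine not_realizes_of_coordinates fun x c hf => ?_
  simp only [doubleCycle, List.forall_mem_cons, List.not_mem_nil, false_implies, implies_true,
    and_true] at hf
  rcases fin_two_eq_zero_or_one (c 0) with h0 | h0 <;>
  rcases fin_two_eq_zero_or_one (c 1) with h1 | h1 <;>
  rcases fin_two_eq_zero_or_one (c 2) with h2 | h2 <;>
  rcases fin_two_eq_zero_or_one (c 3) with h3 | h3 <;>
  rcases fin_two_eq_zero_or_one (c 4) with h4 | h4 <;>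
  rcases fin_two_eq_zero_or_one (c 5) with h5 | h5 <;>
  simp only [h0, h1, h2, h3, h4, h5, tEdge_zero_zero, tEdge_zero_one, tEdge_one_zero, tEdge_one_one] at hf <;>
  omega

theorem not_realizes_tEdge_fiveK : ¬ Realizes tEdge fiveK := by
  refine not_realizes_of_coordinates fun x c hf => ?_
  simp only [fiveK, List.forall_mem_cons, List.not_mem_nil, false_implies, implies_true,
    and_true] at hf
  rcases fin_two_eq_zero_or_one (c 0) with h0 | h0 <;>
  rcases fin_two_eq_zero_or_one (c 1) with h1 | h1 <;>
  rcases fin_two_eq_zero_or_one (c 2) with h2 | h2 <;>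
  rcases fin_two_eq_zero_or_one (c 3) with h3 | h3 <;>
  rcases fin_two_eq_zero_or_one (c 4) with h4 | h4 <;>
  simp only [h0, h1, h2, h3, h4, tEdge_zero_zero, tEdge_zero_one, tEdge_one_zero, tEdge_one_one] at hf <;>
  omega

theorem not_realizes_tEdge_fiveUH : ¬ Realizes tEdge fiveUH := by
  refine not_realizes_of_coordinates fun x c hf => ?_
  simp only [fiveUH, List.forall_mem_cons, List.not_mem_nil, false_implies, implies_true,
    and_true] at hf
  rcases fin_two_eq_zero_or_one (c 0) with h0 | h0 <;>
  rcases fin_two_eq_zero_or_one (c 1) with h1 | h1 <;>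
  rcases fin_two_eq_zero_or_one (c 2) with h2 | h2 <;>
  rcases fin_two_eq_zero_or_one (c 3) with h3 | h3 <;>
  rcases fin_two_eq_zero_or_one (c 4) with h4 | h4 <;>
  simp only [h0, h1, h2, h3, h4, tEdge_zero_zero, tEdge_zero_one, tEdge_one_zero, tEdge_one_one] at hf <;>
  omega

theorem not_realizes_tEdge_fiveVH : ¬ Realizes tEdge fiveVH := by
  refine not_realizes_of_coordinates fun x c hf => ?_
  simp only [fiveVH, List.forall_mem_cons, List.not_mem_nil, false_implies, implies_true,
    and_true] at hf
  rcases fin_two_eq_zero_or_one (c 0) with h0 | h0 <;>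
  rcases fin_two_eq_zero_or_one (c 1) with h1 | h1 <;>
  rcases fin_two_eq_zero_or_one (c 2) with h2 | h2 <;>
  rcases fin_two_eq_zero_or_one (c 3) with h3 | h3 <;>
  rcases fin_two_eq_zero_or_one (c 4) with h4 | h4 <;>
  simp only [h0, h1, h2, h3, h4, tEdge_zero_zero, tEdge_zero_one, tEdge_one_zero, tEdge_one_one] at hf <;>
  omega

theorem not_realizes_uEdge_doubleCycle : ¬ Realizes uEdge doubleCycle := by
  refine not_realizes_of_coordinates fun x c hf => ?_
  simp only [doubleCycle, List.forall_mem_cons, List.not_mem_nil, false_implies, implies_true,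
    and_true] at hf
  rcases fin_two_eq_zero_or_one (c 0) with h0 | h0 <;>
  rcases fin_two_eq_zero_or_one (c 1) with h1 | h1 <;>
  rcases fin_two_eq_zero_or_one (c 2) with h2 | h2 <;>
  rcases fin_two_eq_zero_or_one (c 3) with h3 | h3 <;>
  rcases fin_two_eq_zero_or_one (c 4) with h4 | h4 <;>
  rcases fin_two_eq_zero_or_one (c 5) with h5 | h5 <;>
  simp only [h0, h1, h2, h3, h4, h5, uEdge_zero_zero, uEdge_zero_one, uEdge_one_zero, uEdge_one_one] at hf <;>
  omega

theorem not_realizes_uEdge_fiveK : ¬ Realizes uEdge fiveK := by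
  refine not_realizes_of_coordinates fun x c hf => ?_
  simp only [fiveK, List.forall_mem_cons, List.not_mem_nil, false_implies, implies_true,
    and_true] at hf
  rcases fin_two_eq_zero_or_one (c 0) with h0 | h0 <;>
  rcases fin_two_eq_zero_or_one (c 1) with h1 | h1 <;>
  rcases fin_two_eq_zero_or_one (c 2) with h2 | h2 <;>
  rcases fin_two_eq_zero_or_one (c 3) with h3 | h3 <;>
  rcases fin_two_eq_zero_or_one (c 4) with h4 | h4 <;>
  simp only [h0, h1, h2, h3, h4, uEdge_zero_zero, uEdge_zero_one, uEdge_one_zero, uEdge_one_one] at hf <;>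
  omega

theorem not_realizes_uEdge_regularFive : ¬ Realizes uEdge regularFive := by
  refine not_realizes_of_coordinates fun x c hf => ?_
  simp only [regularFive, List.forall_mem_cons, List.not_mem_nil, false_implies, implies_true,
    and_true] at hf
  rcases fin_two_eq_zero_or_one (c 0) with h0 | h0 <;>
  rcases fin_two_eq_zero_or_one (c 1) with h1 | h1 <;>
  rcases fin_two_eq_zero_or_one (c 2) with h2 | h2 <;>
  rcases fin_two_eq_zero_or_one (c 3) with h3 | h3 <;>
  rcases fin_two_eq_zero_or_one (c 4) with h4 | h4 <;>
  simp only [h0, h1, h2, h3, h4, uEdge_zero_zero, uEdge_zero_one, uEdge_one_zero, uEdge_one_one] at hf <;>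
  omega

theorem not_realizes_uEdge_fiveVH : ¬ Realizes uEdge fiveVH := by
  refine not_realizes_of_coordinates fun x c hf => ?_
  simp only [fiveVH, List.forall_mem_cons, List.not_mem_nil, false_implies, implies_true,
    and_true] at hf
  rcases fin_two_eq_zero_or_one (c 0) with h0 | h0 <;>
  rcases fin_two_eq_zero_or_one (c 1) with h1 | h1 <;>
  rcases fin_two_eq_zero_or_one (c 2) with h2 | h2 <;>
  rcases fin_two_eq_zero_or_one (c 3) with h3 | h3 <;>
  rcases fin_two_eq_zero_or_one (c 4) with h4 | h4 <;>
  simp only [h0, h1, h2, h3, h4, uEdge_zero_zero, uEdge_zero_one, uEdge_one_zero, uEdge_one_one] at hf <;>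
  omega

/-- All 3-cycles would have to share the one vertex sent to `none`, but these two are disjoint. The
next three patterns are excluded in the same way, by 3-cycles with no common vertex. -/
theorem not_realizes_vEdge_doubleCycle : ¬ Realizes vEdge doubleCycle := by
  rintro ⟨f, hf⟩
  -- Every pair of vertices is joined by an edge, so at most one vertex is sent to `none`.
  have hnone : ∀ e ∈ doubleCycle, f e.1 = none → f e.2 ≠ none := fun e he h1 h2 => by
    have h := hf e he
    rw [h1, h2] at h
    exact h
  simp only [doubleCycle, List.forall_mem_cons, List.not_mem_nil, false_implies, implies_true,
    and_true] at hf hnone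
  obtain ⟨h01, h03, h04, h05, h12, h13, h14, h15, h20, h23, h24, h25, h34, h45, h53⟩ := hf
  have c012 := vEdge_exists_eq_none_of_cycle h01 h12 h20
  have c345 := vEdge_exists_eq_none_of_cycle h34 h45 h53
  clear h01 h03 h04 h05 h12 h13 h14 h15 h20 h23 h24 h25 h34 h45 h53
  grind

theorem not_realizes_vEdge_fiveK : ¬ Realizes vEdge fiveK := by
  rintro ⟨f, hf⟩
  have hnone : ∀ e ∈ fiveK, f e.1 = none → f e.2 ≠ none := fun e he h1 h2 => by
    have h := hf e he
    rw [h1, h2] at h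
    exact h
  simp only [fiveK, List.forall_mem_cons, List.not_mem_nil, false_implies, implies_true,
    and_true] at hf hnone
  obtain ⟨h04, h10, h13, h20, h21, h30, h32, h41, h42, h43⟩ := hf
  have c041 := vEdge_exists_eq_none_of_cycle h04 h41 h10
  have c042 := vEdge_exists_eq_none_of_cycle h04 h42 h20
  have c043 := vEdge_exists_eq_none_of_cycle h04 h43 h30
  have c132 := vEdge_exists_eq_none_of_cycle h13 h32 h21
  clear h04 h10 h13 h20 h21 h30 h32 h41 h42 h43
  grind

theorem not_realizes_vEdge_regularFive : ¬ Realizes vEdge regularFive := by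
  rintro ⟨f, hf⟩
  have hnone : ∀ e ∈ regularFive, f e.1 = none → f e.2 ≠ none := fun e he h1 h2 => by
    have h := hf e he
    rw [h1, h2] at h
    exact h
  simp only [regularFive, List.forall_mem_cons, List.not_mem_nil, false_implies, implies_true,
    and_true] at hf hnone
  obtain ⟨h03, h04, h10, h14, h20, h21, h31, h32, h42, h43⟩ := hf
  have c031 := vEdge_exists_eq_none_of_cycle h03 h31 h10
  have c032 := vEdge_exists_eq_none_of_cycle h03 h32 h20
  have c042 := vEdge_exists_eq_none_of_cycle h04 h42 h20
  have c142 := vEdge_exists_eq_none_of_cycle h14 h42 h21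
  have c143 := vEdge_exists_eq_none_of_cycle h14 h43 h31
  clear h03 h04 h10 h14 h20 h21 h31 h32 h42 h43
  grind

theorem not_realizes_vEdge_fiveUH : ¬ Realizes vEdge fiveUH := by
  rintro ⟨f, hf⟩
  have hnone : ∀ e ∈ fiveUH, f e.1 = none → f e.2 ≠ none := fun e he h1 h2 => by
    have h := hf e he
    rw [h1, h2] at h
    exact h
  simp only [fiveUH, List.forall_mem_cons, List.not_mem_nil, false_implies, implies_true,
    and_true] at hf hnone
  obtain ⟨h04, h10, h13, h20, h21, h30, h32, h34, h41, h42⟩ := hf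
  have c041 := vEdge_exists_eq_none_of_cycle h04 h41 h10
  have c042 := vEdge_exists_eq_none_of_cycle h04 h42 h20
  have c132 := vEdge_exists_eq_none_of_cycle h13 h32 h21
  have c134 := vEdge_exists_eq_none_of_cycle h13 h34 h41
  clear h04 h10 h13 h20 h21 h30 h32 h34 h41 h42
  grind

/-- The six tournaments built from `ω`. -/
def omegaFamily : Fin 6 → Tournament :=
  ![C3Of omega, VOf omega, TOf omega, UOf omega, HOf omega, KOf omega]

/-- `doubleCycle` separates `C3Of` from the others, and `strongFour` the others from `C3Of`. Among
the remaining five, `regularFive` occurs only for `TOf` and `fiveK` only for `KOf`. Each of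
`fiveVH`, `fiveUH`, `fiveVU` occurs for exactly two of `VOf`, `UOf`, `HOf`, which separates these
three from one another; the first two patterns also separate them from `TOf` and `KOf`. -/
theorem not_age_omegaFamily_subset (i j : Fin 6) (hij : i ≠ j) :
    ¬ (omegaFamily i).age ⊆ (omegaFamily j).age := by
  fin_cases i <;> fin_cases j
  · exact absurd rfl hij
  · exact not_age_subset realizes_c3Edge_doubleCycle not_realizes_vEdge_doubleCycle
  · exact not_age_subset realizes_c3Edge_doubleCycle not_realizes_tEdge_doubleCycle
  · exact not_age_subset realizes_c3Edge_doubleCycle not_realizes_uEdge_doubleCycle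
  · exact not_age_subset realizes_c3Edge_doubleCycle not_realizes_hEdge_doubleCycle
  · exact not_age_subset realizes_c3Edge_doubleCycle not_realizes_kEdge_doubleCycle
  · exact not_age_subset realizes_vEdge_strongFour not_realizes_c3Edge_strongFour
  · exact absurd rfl hij
  · exact not_age_subset realizes_vEdge_fiveVH not_realizes_tEdge_fiveVH
  · exact not_age_subset realizes_vEdge_fiveVH not_realizes_uEdge_fiveVH
  · exact not_age_subset realizes_vEdge_fiveVU not_realizes_hEdge_fiveVU
  · exact not_age_subset realizes_vEdge_fiveVH not_realizes_kEdge_fiveVH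
  · exact not_age_subset realizes_tEdge_strongFour not_realizes_c3Edge_strongFour
  · exact not_age_subset realizes_tEdge_regularFive not_realizes_vEdge_regularFive
  · exact absurd rfl hij
  · exact not_age_subset realizes_tEdge_regularFive not_realizes_uEdge_regularFive
  · exact not_age_subset realizes_tEdge_regularFive not_realizes_hEdge_regularFive
  · exact not_age_subset realizes_tEdge_regularFive not_realizes_kEdge_regularFive
  · exact not_age_subset realizes_uEdge_strongFour not_realizes_c3Edge_strongFour
  · exact not_age_subset realizes_uEdge_fiveUH not_realizes_vEdge_fiveUH
  · exact not_age_subset realizes_uEdge_fiveUH not_realizes_tEdge_fiveUH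
  · exact absurd rfl hij
  · exact not_age_subset realizes_uEdge_fiveVU not_realizes_hEdge_fiveVU
  · exact not_age_subset realizes_uEdge_fiveUH not_realizes_kEdge_fiveUH
  · exact not_age_subset realizes_hEdge_strongFour not_realizes_c3Edge_strongFour
  · exact not_age_subset realizes_hEdge_fiveUH not_realizes_vEdge_fiveUH
  · exact not_age_subset realizes_hEdge_fiveVH not_realizes_tEdge_fiveVH
  · exact not_age_subset realizes_hEdge_fiveVH not_realizes_uEdge_fiveVH
  · exact absurd rfl hij
  · exact not_age_subset realizes_hEdge_fiveVH not_realizes_kEdge_fiveVH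
  · exact not_age_subset realizes_kEdge_strongFour not_realizes_c3Edge_strongFour
  · exact not_age_subset realizes_kEdge_fiveK not_realizes_vEdge_fiveK
  · exact not_age_subset realizes_kEdge_fiveK not_realizes_tEdge_fiveK
  · exact not_age_subset realizes_kEdge_fiveK not_realizes_uEdge_fiveK
  · exact not_age_subset realizes_kEdge_fiveK not_realizes_hEdge_fiveK
  · exact absurd rfl hij

/-! ### Growth of the profile of `C3Of omega`. -/

/-- The second coordinate never decreases along an edge, so it is constant around a cycle. -/
theorem c3Edge_cycle_snd_eq {u v x : Fin 3 × ℕ} (h1 : c3Edge u v) (h2 : c3Edge v x)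
    (h3 : c3Edge x u) : u.2 = v.2 := by
  obtain ⟨i, a⟩ := u
  obtain ⟨j, b⟩ := v
  obtain ⟨k, d⟩ := x
  rw [c3Edge_iff] at h1 h2 h3
  change a = b
  omega

/-- Points `inl i` in position `3 * i + 1`, and 3-cycles `inr (·, j)` in position `3 * j` or
`3 * j + 2`, according to the value of `c j ∈ {0, 1}`. -/
def pointsAndCycles {p m : ℕ} (c : ℕ → ℕ) : Fin p ⊕ (Fin 3 × Fin m) → Fin 3 × ℕ
  | .inl i => (0, 3 * i + 1)
  | .inr (k, j) => (k, 3 * j + 2 * c j)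

/-- Points have position 1 modulo 3 and cycles 0 or 2, so the position gives the kind of a vertex,
its index and its bit. -/
theorem pointsAndCycles_injective {p m : ℕ} {c : ℕ → ℕ} (hc : ∀ i, c i ≤ 1) :
    Function.Injective (pointsAndCycles c : Fin p ⊕ (Fin 3 × Fin m) → Fin 3 × ℕ) := by
  rintro (i | ⟨k, i⟩) (j | ⟨l, j⟩) h <;> simp only [pointsAndCycles, Prod.mk.injEq] at h
  · rw [Fin.ext (show (i : ℕ) = j by omega)]
  · have := hc j
    omega
  · have := hc i
    omega
  · have := hc i
    have := hc j
    rw [h.1, Fin.ext (show (i : ℕ) = j by omega)]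

/-- An isomorphism between two such subtournaments maps 3-cycles to 3-cycles. -/
theorem exists_cycle_map {p m : ℕ} {c c' : ℕ → ℕ} (hc' : ∀ i, c' i ≤ 1)
    (e : Fin p ⊕ (Fin 3 × Fin m) → Fin p ⊕ (Fin 3 × Fin m)) (hinj : Function.Injective e)
    (he : ∀ u v, c3Edge (pointsAndCycles c u) (pointsAndCycles c v) →
      c3Edge (pointsAndCycles c' (e u)) (pointsAndCycles c' (e v))) :
    ∃ σ : Fin m → Fin m, ∀ k j, ∃ k', e (.inr (k, j)) = .inr (k', σ j) := by
  have hcyc : ∀ k j, c3Edge (pointsAndCycles c' (e (.inr (k, j))))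
      (pointsAndCycles c' (e (.inr (k + 1, j)))) := fun k j =>
    he _ _ ((c3Edge_iff _ _ _ _).2 (Or.inl ⟨rfl, rfl⟩))
  have hsnd : ∀ k j, (pointsAndCycles c' (e (.inr (k, j)))).2 =
      (pointsAndCycles c' (e (.inr (k + 1, j)))).2 := fun k j => by
    refine c3Edge_cycle_snd_eq (hcyc k j) (hcyc (k + 1) j) ?_
    have h := hcyc (k + 1 + 1) j
    rwa [show k + 1 + 1 + 1 = k by omega] at h
  have hinr : ∀ x, ∃ y, e (.inr x) = .inr y := by
    rintro ⟨k, j⟩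
    have h := hsnd k j
    -- A vertex of a cycle cannot go to a point: the next vertex of the cycle would go to the same
    -- position, where that point is alone.
    rcases h1 : e (.inr (k, j)) with i | y
    · exfalso
      rcases h2 : e (.inr (k + 1, j)) with i' | ⟨k', j'⟩
      · rw [h1, h2] at h
        simp only [pointsAndCycles] at h
        rw [← Fin.ext (show (i : ℕ) = i' by omega), ← h1] at h2
        have h3 := hinj h2
        simp at h3
      · rw [h1, h2] at h
        simp only [pointsAndCycles] at h
        have := hc' j'
        omega
    · exact ⟨y, rfl⟩
  choose g hg using hinr
  have hstep : ∀ k j, (g (k, j)).2 = (g (k + 1, j)).2 := fun k j => by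
    have h := hsnd k j
    rw [hg, hg] at h
    have h1 := hc' (g (k, j)).2
    have h2 := hc' (g (k + 1, j)).2
    simp only [pointsAndCycles] at h
    exact Fin.ext (by omega)
  refine ⟨fun j => (g (0, j)).2, fun k j => ⟨(g (k, j)).1, ?_⟩⟩
  have hk : (g (k, j)).2 = (g (0, j)).2 := by
    fin_cases k
    · rfl
    · exact (hstep 0 j).symm
    · exact ((hstep 0 j).trans (hstep 1 j)).symm
  change e _ = .inr (_, (g (0, j)).2)
  rw [hg, ← hk]

/-- An isomorphism maps cycles to cycles and, by the same for its inverse, points to points. It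
preserves the order of the points and that of the cycles, so it fixes all indices, and whether the
i-th point precedes the i-th cycle is invariant. -/
theorem two_pow_le_c3Of (m p : ℕ) (hp : 0 < p) (hmp : m ≤ p) :
    2 ^ m ≤ (p + 3 * m) * (C3Of omega).profile (p + 3 * m) := by
  choose c hc using fun s : Finset (Fin m) => exists_nat_indicator (codeSet s)
  have hc1 : ∀ s i, c s i ≤ 1 := fun s i => (hc s i).1
  have main := (C3Of omega).card_le_mul_profile
    (W := Fin p ⊕ (Fin 3 × Fin m)) (ι := Finset (Fin m))
    (fun s => ⟨pointsAndCycles (c s), pointsAndCycles_injective (hc1 s)⟩) (.inl ⟨0, hp⟩) ?_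
  · simpa using main
  intro s s' e he _
  replace he : ∀ u v, c3Edge (pointsAndCycles (c s) u) (pointsAndCycles (c s) v) ↔
    c3Edge (pointsAndCycles (c s') (e u)) (pointsAndCycles (c s') (e v)) := he
  obtain ⟨σ, hσ⟩ := exists_cycle_map (hc1 s') e e.injective fun u v => (he u v).1
  obtain ⟨τ, hτ⟩ := exists_cycle_map (hc1 s) e.symm e.symm.injective
    (c := c s') fun u v h => (he _ _).2 (by simpa using h)
  -- This makes `σ` injective, which is needed for strict monotonicity: an edge alone does not
  -- exclude that two cycles go into the same one.
  have hτσ : ∀ j, τ (σ j) = j := fun j => by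
    obtain ⟨k, hk⟩ := hσ 0 j
    obtain ⟨k', hk'⟩ := hτ k (σ j)
    rw [← hk, e.symm_apply_apply] at hk'
    simp only [Sum.inr.injEq, Prod.mk.injEq] at hk'
    exact hk'.2.symm
  have hinl : ∀ i, ∃ i', e (.inl i) = .inl i' := fun i => by
    rcases h : e (.inl i) with i' | ⟨k, j⟩
    · exact ⟨i', rfl⟩
    · obtain ⟨k', hk'⟩ := hτ k j
      rw [← h, e.symm_apply_apply] at hk'
      simp at hk'
  choose f hf using hinl
  have hfm : StrictMono f := fun i j hij => by
    have h := (he (.inl i) (.inl j)).1 ((c3Edge_iff _ _ _ _).2 (Or.inr (by omega)))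
    rw [hf, hf] at h
    have h' := (c3Edge_iff _ _ _ _).1 h
    exact Fin.lt_def.2 (by omega)
  have hσm : StrictMono σ := fun i j hij => by
    have h := (he (.inr (0, i)) (.inr (0, j))).1 ((c3Edge_iff _ _ _ _).2 (Or.inr (by
      have := hc1 s i
      omega)))
    obtain ⟨k, hk⟩ := hσ 0 i
    obtain ⟨l, hl⟩ := hσ 0 j
    rw [hk, hl] at h
    have h' := (c3Edge_iff _ _ _ _).1 h
    have h1 := hc1 s' (σ i)
    have h2 := hc1 s' (σ j)
    have hne : (σ i : ℕ) ≠ σ j := fun h3 => hij.ne (by rw [← hτσ i, Fin.ext h3, hτσ])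
    exact Fin.lt_def.2 (by omega)
  have hedge : ∀ (s : Finset (Fin m)) (i : Fin m) (k : Fin 3),
      c3Edge (pointsAndCycles (p := p) (m := m) (c s) (.inl (Fin.castLE hmp i)))
        (pointsAndCycles (p := p) (m := m) (c s) (.inr (k, i))) ↔ i ∈ s := fun s i k => by
    rw [← mem_codeSet, (hc s i).2]
    have := hc1 s i
    refine (c3Edge_iff _ _ _ _).trans ?_
    simp only [Fin.val_castLE]
    omega
  ext i
  obtain ⟨k, hk⟩ := hσ 0 i
  have h := he (.inl (Fin.castLE hmp i)) (.inr (0, i))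
  rw [hf, hk, eq_id_of_strictMono_fin hfm, eq_id_of_strictMono_fin hσm] at h
  exact (hedge s i 0).symm.trans (h.trans (hedge s' i k))

/-! ### Assembling the six cases. -/

theorem omegaFamily_hasChains (i : Fin 6) (hi : i ≠ 0) :
    ∃ r : ℕ → ℕ → Prop, (r = (fun i j => i < j) ∨ r = (fun i j => j < i)) ∧
      HasChains (omegaFamily i).E r := by
  fin_cases i
  · exact absurd rfl hi
  · exact ⟨_, Or.inl rfl, hasChains_vEdge⟩
  · exact ⟨_, Or.inl rfl, hasChains_tEdge⟩
  · exact ⟨_, Or.inr rfl, hasChains_uEdge⟩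
  · exact ⟨_, Or.inl rfl, hasChains_hEdge⟩
  · exact ⟨_, Or.inr rfl, hasChains_kEdge⟩

theorem exists_exponential_lower_bound_omegaFamily (i : Fin 6) :
    ∃ a c : ℝ, 0 < a ∧ 1 < c ∧ ∀ n : ℕ, a * c ^ n ≤ ((omegaFamily i).profile n : ℝ) := by
  refine exists_exponential_lower_bound _ (one_le_profile_zero _) fun n hn => ?_
  by_cases hi : i = 0
  · subst hi
    -- With m = ⌊(n - 1) / 4⌋ cycles, n - 3m ≥ m + 1 vertices remain as points, enough to pair one
    -- with each cycle.
    have h := two_pow_le_c3Of ((n - 1) / 4) (n - 3 * ((n - 1) / 4)) (by omega) (by omega)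
    rwa [show n - 3 * ((n - 1) / 4) + 3 * ((n - 1) / 4) = n by omega] at h
  · obtain ⟨r, hr, h⟩ := omegaFamily_hasChains i hi
    -- One vertex is `a`, m = ⌊(n - 1) / 4⌋ are terms `o i`, and the remaining n - 1 - m ≥ m are
    -- terms `z i`.
    have h := two_pow_le_of_chains _ r hr h ((n - 1) / 4) (n - 1 - (n - 1) / 4) (by omega)
    rwa [show n - 1 - (n - 1) / 4 + (n - 1) / 4 + 1 = n by omega] at h

theorem age_image_frakBOf_dual : age '' frakBOf omega.dual = age '' frakBOf omega := by
  simp only [frakBOf, Set.image_insert_eq, Set.image_singleton]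
  rw [age_dual_eq (F := C3Of) (LocallyEmbeds.lexProd C3), age_dual_eq LocallyEmbeds.vOf,
    age_dual_eq (F := TOf) (LocallyEmbeds.delta _ _),
    age_dual_eq (F := UOf) (LocallyEmbeds.delta _ _),
    age_dual_eq (F := HOf) (LocallyEmbeds.delta _ _),
    age_dual_eq (F := KOf) (LocallyEmbeds.delta _ _)]

theorem range_omegaFamily : Set.range omegaFamily = frakBOf omega := by
  simp only [omegaFamily, frakBOf, Matrix.range_cons, Matrix.range_empty, Set.union_empty,
    Set.singleton_union]

theorem age_image_frakB : age '' frakB = Set.range fun i => (omegaFamily i).age := by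
  rw [frakB, Set.image_union, age_image_frakBOf_dual, Set.union_self, ← range_omegaFamily,
    ← Set.range_comp]
  rfl

end Tournament

theorem lemma4 :
    (Tournament.age '' Tournament.frakB).ncard = 6 ∧
    IsAntichain (fun 𝒜 𝒜' : Set Tournament.IsoType => 𝒜 ⊆ 𝒜')
      (Tournament.age '' Tournament.frakB) ∧
    ∀ T ∈ Tournament.frakB, ∃ a c : ℝ, 0 < a ∧ 1 < c ∧
      ∀ n : ℕ, a * c ^ n ≤ (T.profile n : ℝ) := by
  have hinj : Function.Injective fun i => (Tournament.omegaFamily i).age := by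
    intro i j hij
    by_contra hne
    exact Tournament.not_age_omegaFamily_subset i j hne hij.subset
  refine ⟨?_, ?_, fun T hT => ?_⟩
  · rw [Tournament.age_image_frakB, Set.ncard_range_of_injective hinj, Nat.card_fin]
  · rw [Tournament.age_image_frakB]
    rintro _ ⟨i, rfl⟩ _ ⟨j, rfl⟩ hne
    exact Tournament.not_age_omegaFamily_subset i j fun h => hne (by rw [h])
  -- Even over `ω*`, the age of `T` is that of some tournament over `ω`, whose bound passes to `T`
  -- because the profiles agree.
  · have hage : T.age ∈ Tournament.age '' Tournament.frakB := ⟨T, hT, rfl⟩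
    rw [Tournament.age_image_frakB] at hage
    obtain ⟨i, hi⟩ := hage
    obtain ⟨a, c, ha, hc, h⟩ := Tournament.exists_exponential_lower_bound_omegaFamily i
    refine ⟨a, c, ha, hc, fun n => ?_⟩
    rw [← Tournament.profile_eq_of_age_eq hi]
    exact h n
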